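/- For $y>0$ and $j\in\mathbb{Z}$ let $a_j(\theta)=\frac{e^{ij\theta}}{\sqrt{2\pi y}}$, viewed as an element of $L^2([-\pi y,\pi y])$ (complex-valued, Lebesgue measure). For a finite set $T\subset\mathbb{Z}$ let $A_T:\mathbb{C}^T\to L^2([-\pi y,\pi y])$, $A_Tx=\sum_{j\in T}x_ja_j$, and let $\sigma_{\min}(A_T)$ be its smallest singular value, i.e. the square root of the smallest eigenvalue of $A_T^*A_T$. For an integer $k\ge 1$ define the lower restricted isometry constant \[ \varepsilon_k=\varepsilon_k(y)=\inf_{T\subset\mathbb{Z},\ |T|=k}\sigma_{\min}(A_T). \] Theorem. There exist $C>0$ and $y^*>0$ such that for every integer $n\ge 0$ and every $0<y<y^*$, with $c(y)=\sin(\pi y/2)$, \[ C\left(\frac{c(y)}{4}\right)^{n}\le\varepsilon_{n+1}\le 4\,c(y)^{n}. \] -/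

import Mathlib

open MeasureTheory

noncomputable section

namespace PartialFourier

/-- The least singular value of a bounded operator `A : E → F` from a finite-dimensional space: the
least nonnegative square root of an eigenvalue of `A* A`. -/
def leastSingularValue {E F : Type*} [NormedAddCommGroup E] [InnerProductSpace ℂ E]
    [CompleteSpace E] [NormedAddCommGroup F] [InnerProductSpace ℂ F] [CompleteSpace F]
    (A : E →L[ℂ] F) : ℝ :=
  sInf {s : ℝ | 0 ≤ s ∧
    Module.End.HasEigenvalue
      ((ContinuousLinearMap.adjoint A ∘L A : E →L[ℂ] E) : Module.End ℂ E) ((s ^ 2 : ℝ) : ℂ)}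

/-- The submatrix `A_T` with columns `a j`, `j ∈ T`, as the operator `x ↦ ∑ j ∈ T, x j • a j`. -/
def submatrix {ι F : Type*} [NormedAddCommGroup F] [InnerProductSpace ℂ F]
    (a : ι → F) (T : Finset ι) : EuclideanSpace ℂ T →L[ℂ] F :=
  ∑ j : T, (EuclideanSpace.proj j : EuclideanSpace ℂ T →L[ℂ] ℂ).smulRight (a j)

/-- The lower restricted isometry constant `ε_k` of the matrix with columns `a j`: the infimum of
the least singular value of `A_T` over all sets `T` of exactly `k` column indices. -/
def lowerRIC {ι F : Type*} [NormedAddCommGroup F] [InnerProductSpace ℂ F] [CompleteSpace F]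
    (a : ι → F) (k : ℕ) : ℝ :=
  sInf {s : ℝ | ∃ T : Finset ι, T.card = k ∧ leastSingularValue (submatrix a T) = s}

/-- Lebesgue measure on the interval `[-π y, π y]`. -/
abbrev bandMeasure (y : ℝ) : Measure ℝ :=
  volume.restrict (Set.Icc (-(Real.pi * y)) (Real.pi * y))

/-- The function `θ ↦ e^{i j θ} / √(2 π y)`. -/
def atomFun (y : ℝ) (j : ℤ) (θ : ℝ) : ℂ :=
  Complex.exp (Complex.I * (j : ℂ) * (θ : ℂ)) / ((Real.sqrt (2 * Real.pi * y) : ℝ) : ℂ)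

theorem memLp_atomFun (y : ℝ) (j : ℤ) : MemLp (atomFun y j) 2 (bandMeasure y) := by
  refine MemLp.of_bound (C := 1 / Real.sqrt (2 * Real.pi * y))
    (Continuous.aestronglyMeasurable (by unfold atomFun; fun_prop)) (Filter.Eventually.of_forall ?_)
  intro θ
  have h : ‖Complex.exp (Complex.I * (j : ℂ) * (θ : ℂ))‖ = 1 := by
    have := Complex.norm_exp_ofReal_mul_I ((j : ℝ) * θ)
    rw [← this]
    congr 2
    push_cast
    ring
  rw [atomFun, norm_div, h, Complex.norm_real, Real.norm_of_nonneg (Real.sqrt_nonneg _)]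

/-- The `j`-th column `a_j(θ) = e^{i j θ} / √(2 π y)` of the partial Fourier system, as an element
of `L²([-π y, π y])`. -/
def atom (y : ℝ) (j : ℤ) : Lp ℂ 2 (bandMeasure y) :=
  (memLp_atomFun y j).toLp (atomFun y j)

end PartialFourier

end

/-! Lower bound. A symmetric difference of the shifts of an exponential sum by `±ε`, with suitable
phases, multiplies the coefficient of `e^{ijθ}` by `sin (ε (j - t))`: it kills frequency `t`, does
not increase the `L²` energy, and costs `ε` of the interval at each end (`expSum_shift`,
`integral_expSum_mul_sin_le`). Killing every frequency of `T` but `k` leaves a single term of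
constant modulus, so the energy controls `|x_k|` times a product of sines (`norm_sq_coeff_le`). With
total shift at most `9/10` of the half-length, the worst case is that the distances `|k - t|` are
`1, 1, 2, 2, …`, and `n! ≥ (n/e)^n` bounds the product below by `(0.405 πy/e)^n`. Since `0.405/e >
1/8` and `c(y)/4 ≤ πy/8`, an exponential surplus remains, which absorbs the factor `n + 1` from
summing over `k`.

Upper bound. The test vector is the coefficients of `(1 - z)^n`: its symbol has modulus `|2 sin
(θ/2)|^n`, small on the band, while its squared norm is the central binomial coefficient, of size
nearly `4^n`. -/

namespace PartialFourier

/-! ### Least singular values and Rayleigh quotients -/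

section SingularValues

variable {E F : Type*} [NormedAddCommGroup E] [InnerProductSpace ℂ E] [CompleteSpace E]
  [NormedAddCommGroup F] [InnerProductSpace ℂ F] [CompleteSpace F]

theorem norm_sq_eq_of_hasEigenvalue {A : E →L[ℂ] F} {s : ℝ}
    (h : Module.End.HasEigenvalue
      ((ContinuousLinearMap.adjoint A ∘L A : E →L[ℂ] E) : Module.End ℂ E) ((s ^ 2 : ℝ) : ℂ)) :
    ∃ v : E, v ≠ 0 ∧ ‖A v‖ ^ 2 = s ^ 2 * ‖v‖ ^ 2 := by
  obtain ⟨v, hv⟩ := h.exists_hasEigenvector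
  refine ⟨v, hv.2, ?_⟩
  have h1 : (ContinuousLinearMap.adjoint A ∘L A) v = ((s ^ 2 : ℝ) : ℂ) • v := hv.apply_eq_smul
  have h2 := A.apply_norm_sq_eq_inner_adjoint_left v
  rw [h2, h1, inner_smul_left, inner_self_eq_norm_sq_to_K]
  simp only [Complex.conj_ofReal, Complex.coe_algebraMap, RCLike.re_to_complex]
  norm_cast

/-- In finite dimension the infimum of the Rayleigh quotient of `A* A` is an eigenvalue. Hence the
set defining `leastSingularValue` is nonempty, and any test vector bounds its infimum from above. -/
theorem hasEigenvalue_sqrt_iInf [FiniteDimensional ℂ E] [Nontrivial E] (A : E →L[ℂ] F) :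
    Module.End.HasEigenvalue ((ContinuousLinearMap.adjoint A ∘L A : E →L[ℂ] E) : Module.End ℂ E)
      (((Real.sqrt (⨅ x : {x : E // x ≠ 0}, ‖A x‖ ^ 2 / ‖(x : E)‖ ^ 2)) ^ 2 : ℝ) : ℂ) := by
  have hs : ((ContinuousLinearMap.adjoint A ∘L A : E →L[ℂ] E) : E →ₗ[ℂ] E).IsSymmetric := by
    intro x y
    simp [ContinuousLinearMap.adjoint_inner_left, ContinuousLinearMap.adjoint_inner_right]
  have h := hs.hasEigenvalue_iInf_of_finiteDimensional
  rw [Real.sq_sqrt (Real.iInf_nonneg fun x => by positivity)]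
  have e : (⨅ x : {x : E // x ≠ 0}, ‖A x‖ ^ 2 / ‖(x : E)‖ ^ 2) = ⨅ x : {x : E // x ≠ 0},
      RCLike.re (inner ℂ (((ContinuousLinearMap.adjoint A ∘L A : E →L[ℂ] E) : E →ₗ[ℂ] E) (x : E))
        (x : E)) / ‖(x : E)‖ ^ 2 :=
    iInf_congr fun x => by rw [A.apply_norm_sq_eq_inner_adjoint_left]; rfl
  rw [e]
  exact h

theorem le_leastSingularValue [FiniteDimensional ℂ E] [Nontrivial E] {A : E →L[ℂ] F} {m : ℝ}
    (h : ∀ v, m * ‖v‖ ≤ ‖A v‖) : m ≤ leastSingularValue A := by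
  refine le_csInf ⟨_, Real.sqrt_nonneg _, hasEigenvalue_sqrt_iInf A⟩ ?_
  rintro s ⟨hs, he⟩
  obtain ⟨v, hv, hAv⟩ := norm_sq_eq_of_hasEigenvalue he
  have h1 : ‖A v‖ = s * ‖v‖ := by
    rw [← mul_pow] at hAv
    exact (pow_left_inj₀ (norm_nonneg _) (by positivity) two_ne_zero).1 hAv
  have h2 := h v
  rw [h1] at h2
  exact le_of_mul_le_mul_right h2 (norm_pos_iff.2 hv)

theorem leastSingularValue_nonneg (A : E →L[ℂ] F) : 0 ≤ leastSingularValue A :=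
  Real.sInf_nonneg fun _ hs => hs.1

theorem leastSingularValue_le [FiniteDimensional ℂ E] {A : E →L[ℂ] F} {m : ℝ} (hm : 0 ≤ m) {v : E} (hv : v ≠ 0)
    (h : ‖A v‖ ^ 2 ≤ m ^ 2 * ‖v‖ ^ 2) : leastSingularValue A ≤ m := by
  have : Nontrivial E := ⟨⟨v, 0, hv⟩⟩
  have hle : leastSingularValue A ≤
      Real.sqrt (⨅ x : {x : E // x ≠ 0}, ‖A x‖ ^ 2 / ‖(x : E)‖ ^ 2) :=
    csInf_le ⟨0, fun s hs => hs.1⟩ ⟨Real.sqrt_nonneg _, hasEigenvalue_sqrt_iInf A⟩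
  refine hle.trans ?_
  rw [Real.sqrt_le_left hm]
  refine (ciInf_le ⟨0, ?_⟩ (⟨v, hv⟩ : {x : E // x ≠ 0})).trans ?_
  · rintro _ ⟨x, rfl⟩
    positivity
  · have := norm_pos_iff.2 hv
    exact (div_le_iff₀ (by positivity)).2 h

end SingularValues

/-! ### Exponential sums and their energy on the band -/

/-- The exponential sum `∑ j ∈ T, x j * e^{i j θ}`. -/
noncomputable def expSum (T : Finset ℤ) (x : ℤ → ℂ) (θ : ℝ) : ℂ :=
  ∑ j ∈ T, x j * Complex.exp (Complex.I * (j : ℂ) * (θ : ℂ))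

theorem continuous_expSum (T : Finset ℤ) (x : ℤ → ℂ) : Continuous (expSum T x) := by
  unfold expSum
  fun_prop

theorem norm_sq_submatrix_atom {y : ℝ} (hy : 0 < y) (T : Finset ℤ) (x : ℤ → ℂ) :
    ‖submatrix (atom y) T (WithLp.toLp 2 fun j : T => x j)‖ ^ 2 =
      (∫ θ in -(Real.pi * y)..Real.pi * y, ‖expSum T x θ‖ ^ 2) / (2 * Real.pi * y) := by
  have hpy : 0 < Real.pi * y := by positivity
  have h1 : submatrix (atom y) T (WithLp.toLp 2 fun j : T => x j) = ∑ j ∈ T, x j • atom y j := by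
    simp only [submatrix, sum_apply, ContinuousLinearMap.smulRight_apply]
    exact Finset.sum_coe_sort T fun j => x j • atom y j
  have h2 : (∑ j ∈ T, x j • atom y j : Lp ℂ 2 (bandMeasure y)) =ᵐ[bandMeasure y]
      fun θ => expSum T x θ / ((Real.sqrt (2 * Real.pi * y) : ℝ) : ℂ) := by
    have h3 : ∀ S : Finset ℤ, (∑ j ∈ S, x j • atom y j : Lp ℂ 2 (bandMeasure y)) =ᵐ[bandMeasure y]
        fun θ => ∑ j ∈ S, x j * atomFun y j θ := by
      intro S
      induction S using Finset.induction_on with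
      | empty =>
        simp only [Finset.sum_empty]
        exact Lp.coeFn_zero _ _ _
      | insert a S ha ih =>
        rw [Finset.sum_insert ha]
        filter_upwards [Lp.coeFn_add (x a • atom y a) (∑ j ∈ S, x j • atom y j), ih,
          Lp.coeFn_smul (x a) (atom y a), (memLp_atomFun y a).coeFn_toLp] with θ e1 e2 e3 e4
        rw [e1, Pi.add_apply, e2, e3, Pi.smul_apply, Finset.sum_insert ha]
        congr 1
        rw [smul_eq_mul, atom, e4]
    filter_upwards [h3 T] with θ e
    rw [e, expSum, Finset.sum_div]
    exact Finset.sum_congr rfl fun j _ => by rw [atomFun, mul_div_assoc]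
  have h4 : inner ℂ (∑ j ∈ T, x j • atom y j : Lp ℂ 2 (bandMeasure y)) (∑ j ∈ T, x j • atom y j) =
      ((∫ θ, ‖expSum T x θ‖ ^ 2 / (2 * Real.pi * y) ∂bandMeasure y : ℝ) : ℂ) := by
    rw [L2.inner_def, ← integral_complex_ofReal]
    refine integral_congr_ae ?_
    filter_upwards [h2] with θ e
    rw [e, inner_self_eq_norm_sq_to_K, norm_div, Complex.norm_real,
      Real.norm_of_nonneg (Real.sqrt_nonneg _)]
    simp only [Complex.coe_algebraMap]
    rw [← Complex.ofReal_pow, div_pow, Real.sq_sqrt (by positivity)]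
  rw [h1, @norm_sq_eq_re_inner ℂ, h4, RCLike.re_to_complex, Complex.ofReal_re, integral_div,
    intervalIntegral.integral_of_le (by linarith), ← integral_Icc_eq_integral_Ioc]

/-! ### Lower bounds for products of sines -/

theorem sin_ge_mul {x : ℝ} (h0 : 0 ≤ x) (h1 : x ≤ 1 / 2) : 9 / 10 * x ≤ Real.sin x := by
  rcases h0.eq_or_lt with rfl | h
  · simp
  · nlinarith [Real.sin_gt_sub_cube h, mul_nonneg h.le (sub_nonneg.2 h1), mul_nonneg (mul_nonneg h.le h.le) (sub_nonneg.2 h1)]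

/-- At most two nonzero integers share an absolute value, so the sorted absolute values of `S`
dominate `1, 1, 2, 2, 3, …` termwise. -/
theorem prod_range_le_prod_natAbs {s : ℕ → ℝ} (hs : Monotone s) (h0 : ∀ m, 0 ≤ s m) :
    ∀ (n : ℕ) (S : Finset ℤ), S.card = n → 0 ∉ S →
      ∏ i ∈ Finset.range n, s (i / 2 + 1) ≤ ∏ j ∈ S, s j.natAbs := by
  intro n
  induction n with
  | zero =>
    intro S hS _
    rw [Finset.card_eq_zero.1 hS]
    simp
  | succ n ih =>
    intro S hS h
    -- Pigeonhole: only `2 * (n / 2) ≤ n` nonzero integers have absolute value at most `n / 2`, and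
    -- `S` has `n + 1` elements.
    obtain ⟨j, hj, hmax⟩ : ∃ j ∈ S, n / 2 + 1 ≤ j.natAbs := by
      by_contra! hc
      have hsub : S ⊆ (Finset.Icc (-((n / 2 : ℕ) : ℤ)) ((n / 2 : ℕ) : ℤ)).erase 0 := by
        intro j hj
        have := hc j hj
        rw [Finset.mem_erase, Finset.mem_Icc]
        refine ⟨fun e => h (e ▸ hj), ?_, ?_⟩ <;> omega
      have hcard := Finset.card_le_card hsub
      rw [Finset.card_erase_of_mem (Finset.mem_Icc.2 ⟨by omega, by omega⟩), Int.card_Icc] at hcard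
      omega
    rw [Finset.prod_range_succ, ← Finset.prod_erase_mul S _ hj]
    refine mul_le_mul (ih _ (by rw [Finset.card_erase_of_mem hj, hS]; rfl)
      fun hh => h (Finset.mem_of_mem_erase hh)) (hs hmax) (h0 _)
      (Finset.prod_nonneg fun _ _ => h0 _)

theorem pow_self_le_factorial_mul_exp (n : ℕ) : (n : ℝ) ^ n ≤ n.factorial * Real.exp 1 ^ n := by
  have := Real.pow_div_factorial_le_exp (n : ℝ) n.cast_nonneg n
  rw [div_le_iff₀ (by positivity)] at this
  rwa [← Real.exp_nat_mul, mul_one, mul_comm]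

theorem pow_le_prod_sin {a : ℝ} (ha : 0 ≤ a) (ha1 : a ≤ 1 / 2) (n : ℕ) :
    (9 / 10 * a / (2 * Real.exp 1)) ^ n ≤
      ∏ i ∈ Finset.range n, Real.sin (min (a / n * (i / 2 + 1 : ℕ)) (Real.pi / 2)) := by
  rcases Nat.eq_zero_or_pos n with rfl | hn
  · simp
  have hn' : (0 : ℝ) < n := by exact_mod_cast hn
  have h1 : ∏ i ∈ Finset.range n, (9 / 10 * (a / n) / 2 * (i + 1 : ℝ)) ≤
      ∏ i ∈ Finset.range n, Real.sin (min (a / n * (i / 2 + 1 : ℕ)) (Real.pi / 2)) := by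
    refine Finset.prod_le_prod (fun i _ => by positivity) fun i hi => ?_
    have hi' := Finset.mem_range.1 hi
    have e1 : (i / 2 + 1 : ℕ) ≤ (n : ℝ) := by exact_mod_cast (by omega : i / 2 + 1 ≤ n)
    have e2 : (i + 1 : ℝ) ≤ 2 * (i / 2 + 1 : ℕ) := by
      exact_mod_cast (by omega : i + 1 ≤ 2 * (i / 2 + 1))
    have e3 : a / n * (i / 2 + 1 : ℕ) ≤ a := by
      calc _ ≤ a / n * n := by gcongr
        _ = a := by field_simp
    have e4 : 0 ≤ a / n * (i / 2 + 1 : ℕ) := by positivity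
    -- The cap at `π / 2` is inactive here; it serves only to make the sine monotone at large
    -- distances.
    rw [min_eq_left (by linarith [Real.pi_gt_three])]
    refine le_trans ?_ (sin_ge_mul e4 (e3.trans ha1))
    calc 9 / 10 * (a / n) / 2 * (i + 1 : ℝ) ≤ 9 / 10 * (a / n) / 2 * (2 * (i / 2 + 1 : ℕ)) := by gcongr
      _ = _ := by ring
  refine le_trans ?_ h1
  rw [Finset.prod_mul_distrib, Finset.prod_const, Finset.card_range]
  have h2 : ∏ i ∈ Finset.range n, (i + 1 : ℝ) = n.factorial := by
    rw [← Finset.prod_range_add_one_eq_factorial]; push_cast; rfl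
  rw [h2]
  have h3 : 9 / 10 * a / (2 * Real.exp 1) = 9 / 10 * (a / n) / 2 * (n / Real.exp 1) := by
    field_simp
  rw [h3, mul_pow]
  gcongr
  rw [div_pow, div_le_iff₀ (by positivity)]
  exact pow_self_le_factorial_mul_exp n

theorem monotone_sin_min {b : ℝ} (hb : 0 ≤ b) :
    Monotone fun m : ℕ => Real.sin (min (b * m) (Real.pi / 2)) := by
  intro m k hmk
  have : (m : ℝ) ≤ k := by exact_mod_cast hmk
  refine Real.sin_le_sin_of_le_of_le_pi_div_two ?_ (min_le_right _ _) (by gcongr)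
  have : 0 ≤ min (b * m) (Real.pi / 2) := le_min (by positivity) (by positivity)
  linarith [Real.pi_pos]

theorem sin_min_nonneg {b : ℝ} (hb : 0 ≤ b) (m : ℕ) :
    0 ≤ Real.sin (min (b * m) (Real.pi / 2)) :=
  Real.sin_nonneg_of_nonneg_of_le_pi (le_min (by positivity) (by positivity))
    ((min_le_right _ _).trans (by linarith [Real.pi_pos]))

/-! ### Annihilating frequencies by shifts -/

theorem expSum_shift (T : Finset ℤ) (x : ℤ → ℂ) (t : ℤ) (ε θ : ℝ) :
    2 * Complex.I * expSum T (fun j => x j * (Real.sin (ε * (j - t)) : ℂ)) θ =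
      Complex.exp (-(ε * t : ℝ) * Complex.I) * expSum T x (θ + ε) -
        Complex.exp ((ε * t : ℝ) * Complex.I) * expSum T x (θ - ε) := by
  unfold expSum
  rw [Finset.mul_sum, Finset.mul_sum, Finset.mul_sum, ← Finset.sum_sub_distrib]
  refine Finset.sum_congr rfl fun j _ => ?_
  have e1 : Complex.exp (-(ε * t : ℝ) * Complex.I) *
      (x j * Complex.exp (Complex.I * j * ((θ + ε : ℝ) : ℂ))) =
      x j * Complex.exp (Complex.I * j * θ) * Complex.exp ((ε * (j - t) : ℝ) * Complex.I) := by
    rw [mul_left_comm, ← Complex.exp_add, mul_assoc (x j), ← Complex.exp_add]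
    congr 2
    push_cast
    ring
  have e2 : Complex.exp ((ε * t : ℝ) * Complex.I) *
      (x j * Complex.exp (Complex.I * j * ((θ - ε : ℝ) : ℂ))) =
      x j * Complex.exp (Complex.I * j * θ) * Complex.exp (-(ε * (j - t) : ℝ) * Complex.I) := by
    rw [mul_left_comm, ← Complex.exp_add, mul_assoc (x j), ← Complex.exp_add]
    congr 2
    push_cast
    ring
  beta_reduce
  rw [e1, e2, ← mul_sub, Complex.ofReal_sin, Complex.sin]
  linear_combination (-(x j * Complex.exp (Complex.I * j * θ)) *
    (Complex.exp ((ε * (j - t) : ℝ) * Complex.I) -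
      Complex.exp (-(ε * (j - t) : ℝ) * Complex.I))) * Complex.I_sq

theorem norm_sq_expSum_mul_sin_le (T : Finset ℤ) (x : ℤ → ℂ) (t : ℤ) (ε θ : ℝ) :
    ‖expSum T (fun j => x j * (Real.sin (ε * (j - t)) : ℂ)) θ‖ ^ 2 ≤
      (‖expSum T x (θ + ε)‖ ^ 2 + ‖expSum T x (θ - ε)‖ ^ 2) / 2 := by
  have h := congrArg norm (expSum_shift T x t ε θ)
  have h' := norm_sub_le (Complex.exp (-(ε * t : ℝ) * Complex.I) * expSum T x (θ + ε))
    (Complex.exp ((ε * t : ℝ) * Complex.I) * expSum T x (θ - ε))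
  rw [← h, norm_mul, norm_mul, norm_mul, norm_mul, ← Complex.ofReal_neg,
    Complex.norm_exp_ofReal_mul_I, Complex.norm_exp_ofReal_mul_I, Complex.norm_I] at h'
  simp only [Complex.norm_ofNat, mul_one, one_mul] at h'
  have h0 := norm_nonneg (expSum T (fun j => x j * (Real.sin (ε * (j - t)) : ℂ)) θ)
  nlinarith [sq_nonneg (‖expSum T x (θ + ε)‖ - ‖expSum T x (θ - ε)‖)]

/-- Both shifts by `±ε` of the shortened interval stay inside `[-R, R]`, so the average of the two
shifted energies is at most the full energy. -/
theorem integral_expSum_mul_sin_le (T : Finset ℤ) (x : ℤ → ℂ) (t : ℤ) {R ε : ℝ} (h0 : 0 ≤ ε)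
    (hR : ε ≤ R) :
    ∫ θ in -(R - ε)..R - ε, ‖expSum T (fun j => x j * (Real.sin (ε * (j - t)) : ℂ)) θ‖ ^ 2 ≤
      ∫ θ in -R..R, ‖expSum T x θ‖ ^ 2 := by
  have hc : ∀ z, Continuous fun θ => ‖expSum T z θ‖ ^ 2 := fun z =>
    (continuous_expSum T z).norm.pow 2
  have hp : Continuous fun θ => ‖expSum T x (θ + ε)‖ ^ 2 := (hc x).comp (continuous_add_const ε)
  have hm : Continuous fun θ => ‖expSum T x (θ - ε)‖ ^ 2 := (hc x).comp (continuous_sub_right ε)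
  have h1 := intervalIntegral.integral_mono_on (μ := volume) (a := -(R - ε)) (b := R - ε) (by linarith)
    ((hc _).intervalIntegrable _ _) (((hp.add hm).div_const 2).intervalIntegrable _ _)
    fun θ _ => norm_sq_expSum_mul_sin_le T x t ε θ
  refine h1.trans ?_
  have h2 : ∀ a b : ℝ, -R ≤ a → a ≤ b → b ≤ R →
      ∫ θ in a..b, ‖expSum T x θ‖ ^ 2 ≤ ∫ θ in -R..R, ‖expSum T x θ‖ ^ 2 := fun a b ha hab hb =>
    intervalIntegral.integral_mono_interval ha hab hb
      (Filter.Eventually.of_forall fun θ => by positivity) ((hc x).intervalIntegrable _ _)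
  simp only [Pi.add_apply]
  rw [intervalIntegral.integral_div, intervalIntegral.integral_add (hp.intervalIntegrable _ _)
    (hm.intervalIntegrable _ _), intervalIntegral.integral_comp_add_right
    (fun θ => ‖expSum T x θ‖ ^ 2), intervalIntegral.integral_comp_sub_right
    (fun θ => ‖expSum T x θ‖ ^ 2)]
  linarith [h2 (-(R - ε) + ε) (R - ε + ε) (by linarith) (by linarith) (by linarith),
    h2 (-(R - ε) - ε) (R - ε - ε) (by linarith) (by linarith) (by linarith)]

theorem integral_expSum_mul_prod_sin_le (T : Finset ℤ) (x : ℤ → ℂ) {ε : ℤ → ℝ}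
    (h0 : ∀ t, 0 ≤ ε t) {R : ℝ} (S : Finset ℤ) (hR : ∑ t ∈ S, ε t ≤ R) :
    ∫ θ in -(R - ∑ t ∈ S, ε t)..R - ∑ t ∈ S, ε t,
      ‖expSum T (fun j => x j * ∏ t ∈ S, (Real.sin (ε t * (j - t)) : ℂ)) θ‖ ^ 2 ≤
      ∫ θ in -R..R, ‖expSum T x θ‖ ^ 2 := by
  induction S using Finset.induction_on with
  | empty => simp
  | insert t S ht ih =>
    rw [Finset.sum_insert ht] at hR ⊢
    have h1 := ih (by linarith [h0 t])
    have h2 := integral_expSum_mul_sin_le T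
      (fun j => x j * ∏ t ∈ S, (Real.sin (ε t * (j - t)) : ℂ)) t (h0 t)
      (by linarith : ε t ≤ R - ∑ t ∈ S, ε t)
    refine le_trans (le_of_eq ?_) (h2.trans h1)
    rw [show R - (ε t + ∑ t ∈ S, ε t) = R - ∑ t ∈ S, ε t - ε t by ring]
    simp only [Finset.prod_insert ht, mul_assoc, mul_comm (Complex.ofReal (Real.sin _))]

/-- The factor for `t = j` vanishes at each `j ≠ k`, so the filtered sum is one exponential and its
energy is exactly the left side. -/
theorem norm_sq_coeff_le {T : Finset ℤ} {k : ℤ} (hk : k ∈ T) (x : ℤ → ℂ) {ε : ℤ → ℝ}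
    (h0 : ∀ t, 0 ≤ ε t) {R : ℝ} (hR : ∑ t ∈ T.erase k, ε t ≤ R) :
    2 * (R - ∑ t ∈ T.erase k, ε t) *
      (‖x k‖ * ∏ t ∈ T.erase k, |Real.sin (ε t * (k - t))|) ^ 2 ≤
      ∫ θ in -R..R, ‖expSum T x θ‖ ^ 2 := by
  refine le_trans (le_of_eq ?_) (integral_expSum_mul_prod_sin_le T x h0 (T.erase k) hR)
  have h : ∀ θ, ‖expSum T (fun j => x j * ∏ t ∈ T.erase k, (Real.sin (ε t * (j - t)) : ℂ)) θ‖ ^ 2 =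
      (‖x k‖ * ∏ t ∈ T.erase k, |Real.sin (ε t * (k - t))|) ^ 2 := by
    intro θ
    unfold expSum
    rw [Finset.sum_eq_single_of_mem k hk]
    · rw [norm_mul, norm_mul, norm_prod, mul_assoc Complex.I, mul_comm Complex.I,
        ← Complex.ofReal_intCast, ← Complex.ofReal_mul, Complex.norm_exp_ofReal_mul_I, mul_one]
      simp only [Complex.norm_real, Real.norm_eq_abs]
    · intro j hj hjk
      beta_reduce
      rw [Finset.prod_eq_zero (Finset.mem_erase.2 ⟨hjk, hj⟩) (by simp), mul_zero, zero_mul]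
  simp only [h, intervalIntegral.integral_const, smul_eq_mul]
  ring

theorem norm_sq_coeff_le_integral {T : Finset ℤ} {n : ℕ} (hT : T.card = n + 1) {k : ℤ} (hk : k ∈ T)
    (x : ℤ → ℂ) {R : ℝ} (hR : 0 ≤ R) (hR1 : R ≤ 1 / 2) :
    R / 5 * (‖x k‖ * (81 / 200 * R / Real.exp 1) ^ n) ^ 2 ≤
      ∫ θ in -R..R, ‖expSum T x θ‖ ^ 2 := by
  set a := 9 / 10 * R with ha
  have ha0 : 0 ≤ a := by positivity
  set b := a / n with hb
  have hb0 : 0 ≤ b := by positivity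
  -- Equal shares of the shift budget `a`, reduced where needed so that `ε t * |k - t| ≤ π / 2`.
  set ε : ℤ → ℝ := fun t => min b (Real.pi / 2 / (k - t).natAbs) with hε
  have h0 : ∀ t, 0 ≤ ε t := fun t => le_min hb0 (by positivity)
  have hcard : (T.erase k).card = n := by rw [Finset.card_erase_of_mem hk, hT]; rfl
  have hsum : ∑ t ∈ T.erase k, ε t ≤ a := by
    refine (Finset.sum_le_card_nsmul _ _ b fun t _ => min_le_left _ _).trans ?_
    rw [hcard, nsmul_eq_mul, hb]
    -- For `n = 0`, `b = a / 0 = 0` and there is nothing to kill.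
    rcases eq_or_ne (n : ℝ) 0 with h | h
    · rwa [h, zero_mul]
    · rw [mul_div_cancel₀ _ h]
  have hsin : ∀ t ∈ T.erase k, Real.sin (min (b * (k - t).natAbs) (Real.pi / 2)) =
      |Real.sin (ε t * (k - t))| := by
    intro t ht
    have hne : 0 < ((k - t).natAbs : ℝ) := by
      have := (Finset.mem_erase.1 ht).1
      exact_mod_cast (by omega : 0 < (k - t).natAbs)
    have e1 : min (b * (k - t).natAbs) (Real.pi / 2) = ε t * (k - t).natAbs := by
      rw [hε, min_mul_of_nonneg _ _ hne.le, div_mul_cancel₀ _ hne.ne']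
    have e2 : |(k - t : ℝ)| = (k - t).natAbs := by
      rw [Nat.cast_natAbs]; push_cast; rfl
    rw [← abs_of_nonneg (sin_min_nonneg hb0 _), e1, ← e2]
    rcases abs_choice (k - t : ℝ) with h | h <;> rw [h]
    rw [mul_neg, Real.sin_neg, abs_neg]
  have hprod : (81 / 200 * R / Real.exp 1) ^ n ≤
      ∏ t ∈ T.erase k, |Real.sin (ε t * (k - t))| := by
    have e1 := pow_le_prod_sin ha0 (by linarith : a ≤ 1 / 2) n
    have hinj : Function.Injective fun t : ℤ => k - t := sub_right_injective
    have e2 := prod_range_le_prod_natAbs (monotone_sin_min hb0) (sin_min_nonneg hb0) n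
      ((T.erase k).image fun t => k - t) (by rw [Finset.card_image_of_injective _ hinj, hcard])
      (by
        simp only [Finset.mem_image, not_exists, not_and]
        intro t ht h
        exact (Finset.mem_erase.1 ht).1 (by omega))
    rw [Finset.prod_image hinj.injOn, Finset.prod_congr rfl hsin] at e2
    refine le_trans (le_of_eq ?_) (e1.trans e2)
    congr 1
    rw [ha]
    ring
  -- The shifts use at most `9 R / 10`, so the remaining interval has length at least `R / 5`.
  refine le_trans ?_ (norm_sq_coeff_le hk x h0 (by linarith : _ ≤ R))
  refine mul_le_mul (by linarith) ?_ (by positivity) (by linarith)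
  gcongr

theorem norm_sq_le_norm_sq_submatrix_atom {T : Finset ℤ} {n : ℕ} (hT : T.card = n + 1) {y : ℝ}
    (hy : 0 < y) (hy1 : y ≤ 1 / 10) (v : EuclideanSpace ℂ T) :
    (81 / 200 * (Real.pi * y) / Real.exp 1) ^ (2 * n) * ‖v‖ ^ 2 ≤
      10 * (n + 1) * ‖submatrix (atom y) T v‖ ^ 2 := by
  set x : ℤ → ℂ := fun j => if h : j ∈ T then v ⟨j, h⟩ else 0 with hx
  have hv : v = WithLp.toLp 2 fun j : T => x j := by
    ext j
    simp [hx]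
  have hR : Real.pi * y ≤ 1 / 2 := by nlinarith [Real.pi_lt_four, Real.pi_pos]
  have hRpos : 0 < Real.pi * y := by positivity
  rw [hv, norm_sq_submatrix_atom hy, EuclideanSpace.norm_sq_eq]
  simp only
  rw [Finset.sum_coe_sort T fun j => ‖x j‖ ^ 2, Finset.mul_sum]
  have h : ∀ k ∈ T, (81 / 200 * (Real.pi * y) / Real.exp 1) ^ (2 * n) * ‖x k‖ ^ 2 ≤
      10 * ((∫ θ in -(Real.pi * y)..Real.pi * y, ‖expSum T x θ‖ ^ 2) / (2 * Real.pi * y)) := by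
    intro k hk
    rw [mul_div_assoc', le_div_iff₀ (by positivity)]
    have := norm_sq_coeff_le_integral hT hk x hRpos.le hR
    rw [mul_pow, ← pow_mul, mul_comm n 2] at this
    linarith
  refine (Finset.sum_le_card_nsmul _ _ _ h).trans (le_of_eq ?_)
  rw [hT, nsmul_eq_mul]
  push_cast
  ring

theorem le_leastSingularValue_atom {T : Finset ℤ} {n : ℕ} (hT : T.card = n + 1) {y : ℝ}
    (hy : 0 < y) (hy1 : y ≤ 1 / 10) :
    1 / 5 * (Real.sin (Real.pi * y / 2) / 4) ^ n ≤
      leastSingularValue (submatrix (atom y) T) := by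
  have hne : Nonempty T := (Finset.card_pos.1 (by omega)).to_subtype
  refine le_leastSingularValue fun v => ?_
  have h := norm_sq_le_norm_sq_submatrix_atom hT hy hy1 v
  have hpy : 0 < Real.pi * y := by positivity
  have hc0 : 0 ≤ Real.sin (Real.pi * y / 2) :=
    Real.sin_nonneg_of_nonneg_of_le_pi (by positivity) (by nlinarith [Real.pi_pos])
  have hc1 : Real.sin (Real.pi * y / 2) ≤ Real.pi * y / 2 := Real.sin_le (by positivity)
  set c := Real.sin (Real.pi * y / 2)
  set q := 81 / 200 * (Real.pi * y) / Real.exp 1 with hq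
  -- `c / 4 ≤ πy / 8`, and `0.405 / e ≈ 0.14899` exceeds `1.19 / 8 = 0.14875`.
  have h1 : 119 / 100 * (c / 4) ≤ q := by
    rw [hq, le_div_iff₀ (Real.exp_pos 1)]
    have := Real.exp_one_lt_d9
    nlinarith
  have h2 : 7 / 5 * (c / 4) ^ 2 ≤ q ^ 2 := by
    calc 7 / 5 * (c / 4) ^ 2 ≤ (119 / 100 * (c / 4)) ^ 2 := by nlinarith [sq_nonneg (c / 4)]
      _ ≤ q ^ 2 := by gcongr
  have h3 : (7 / 5 : ℝ) ^ n * (c / 4) ^ (2 * n) ≤ q ^ (2 * n) := by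
    rw [pow_mul, pow_mul, ← mul_pow]
    gcongr
  -- Bernoulli: the surplus `1.19² > 7/5` per step pays for the factor `n + 1`.
  have h4 : (2 / 5 : ℝ) * (n + 1) ≤ (7 / 5) ^ n := by
    have := one_add_mul_le_pow (by norm_num : (-2 : ℝ) ≤ 2 / 5) n
    norm_num at this ⊢
    linarith
  have h5 : (2 / 5 : ℝ) * (n + 1) * (c / 4) ^ (2 * n) * ‖v‖ ^ 2 ≤
      10 * (n + 1) * ‖submatrix (atom y) T v‖ ^ 2 := by
    refine le_trans ?_ h
    gcongr
    refine le_trans ?_ h3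
    gcongr
  have hn : (0 : ℝ) < n + 1 := by positivity
  have h6 : (1 / 5 * (c / 4) ^ n * ‖v‖) ^ 2 ≤ ‖submatrix (atom y) T v‖ ^ 2 := by
    refine le_of_mul_le_mul_left ?_ (by positivity : (0 : ℝ) < 10 * (n + 1))
    refine le_trans (le_of_eq ?_) h5
    rw [mul_pow, mul_pow, ← pow_mul, mul_comm n 2]
    ring
  exact (pow_le_pow_iff_left₀ (by positivity) (norm_nonneg _) two_ne_zero).1 h6

/-! ### Upper bound from the binomial test vector -/

/-- Inserting `2 cos (θ/2) ≥ 1` makes the integrand an exact derivative. The resulting factor `2n +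
1` cancels the loss in `4^n ≤ (2n + 1) * (2n).choose n`. -/
theorem integral_sin_half_pow_le {a : ℝ} (ha : 0 < a) (ha1 : a ≤ 1 / 2) (n : ℕ) :
    (2 * n + 1) * ∫ θ in -a..a, Real.sin (θ / 2) ^ (2 * n) ≤ 4 * a * Real.sin (a / 2) ^ (2 * n) := by
  have hcos : ∀ θ, θ ∈ Set.Icc (-a) a → (1 / 2 : ℝ) ≤ Real.cos (θ / 2) := by
    intro θ hθ
    have := Real.one_sub_sq_div_two_le_cos (x := θ / 2)
    nlinarith [hθ.1, hθ.2]
  have h1 : ∫ θ in -a..a, Real.sin (θ / 2) ^ (2 * n) ≤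
      ∫ θ in -a..a, 2 * (Real.sin (θ / 2) ^ (2 * n) * Real.cos (θ / 2)) := by
    refine intervalIntegral.integral_mono_on (by linarith)
      (Continuous.intervalIntegrable (by fun_prop) _ _)
      (Continuous.intervalIntegrable (by fun_prop) _ _) fun θ hθ => ?_
    have hs : 0 ≤ Real.sin (θ / 2) ^ (2 * n) := (even_two_mul n).pow_nonneg _
    nlinarith [hcos θ hθ]
  have h2 : ∫ θ in -a..a, (2 * n + 1) * (2 * (Real.sin (θ / 2) ^ (2 * n) * Real.cos (θ / 2))) =
      4 * Real.sin (a / 2) ^ (2 * n + 1) - 4 * Real.sin (-a / 2) ^ (2 * n + 1) := by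
    refine intervalIntegral.integral_eq_sub_of_hasDerivAt
      (f := fun θ => 4 * Real.sin (θ / 2) ^ (2 * n + 1)) (fun θ _ => ?_)
      (Continuous.intervalIntegrable (by fun_prop) _ _)
    have := ((((hasDerivAt_id θ).div_const 2).sin).pow (2 * n + 1)).const_mul 4
    refine this.congr_deriv ?_
    simp
    ring
  rw [intervalIntegral.integral_const_mul, neg_div, Real.sin_neg,
    (odd_two_mul_add_one n).neg_pow] at h2
  have h3 : Real.sin (a / 2) ≤ a / 2 := Real.sin_le (by positivity)
  have h4 : 0 ≤ Real.sin (a / 2) ^ (2 * n) := (even_two_mul n).pow_nonneg _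
  calc _ ≤ (2 * n + 1) * ∫ θ in -a..a, 2 * (Real.sin (θ / 2) ^ (2 * n) * Real.cos (θ / 2)) := by
        gcongr
    _ = 8 * (Real.sin (a / 2) ^ (2 * n) * Real.sin (a / 2)) := by rw [h2]; ring
    _ ≤ 8 * (Real.sin (a / 2) ^ (2 * n) * (a / 2)) := by gcongr
    _ = _ := by ring

theorem norm_one_sub_exp_sq (θ : ℝ) :
    ‖1 - Complex.exp (Complex.I * θ)‖ ^ 2 = 4 * Real.sin (θ / 2) ^ 2 := by
  rw [norm_sub_rev, Complex.norm_exp_I_mul_ofReal_sub_one, Real.norm_eq_abs, sq_abs, mul_pow]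
  norm_num

/-- The coefficients of `(1 - z) ^ n`. -/
def binomialCoeff (n : ℕ) (j : ℤ) : ℂ := (-1) ^ j.toNat * (n.choose j.toNat : ℂ)

theorem expSum_binomialCoeff (n : ℕ) (θ : ℝ) :
    expSum ((Finset.range (n + 1)).map Nat.castEmbedding) (binomialCoeff n) θ =
      (1 - Complex.exp (Complex.I * θ)) ^ n := by
  rw [expSum, Finset.sum_map, sub_eq_neg_add, add_pow]
  refine Finset.sum_congr rfl fun m _ => ?_
  simp only [binomialCoeff, Nat.castEmbedding_apply, Int.toNat_natCast, Int.cast_natCast, one_pow,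
    mul_one]
  rw [neg_pow (Complex.exp _), ← Complex.exp_nat_mul]
  ring_nf

theorem sum_norm_sq_binomialCoeff (n : ℕ) :
    ∑ j ∈ (Finset.range (n + 1)).map Nat.castEmbedding, ‖binomialCoeff n j‖ ^ 2 =
      ((2 * n).choose n : ℝ) := by
  rw [Finset.sum_map, ← Nat.sum_range_choose_sq]
  push_cast
  exact Finset.sum_congr rfl fun m _ => by simp [binomialCoeff]

theorem leastSingularValue_atom_le (n : ℕ) {y : ℝ} (hy : 0 < y) (hy1 : y ≤ 1 / 10) :
    leastSingularValue (submatrix (atom y) ((Finset.range (n + 1)).map Nat.castEmbedding)) ≤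
      4 * Real.sin (Real.pi * y / 2) ^ n := by
  have hpy : 0 < Real.pi * y := by positivity
  have hR : Real.pi * y ≤ 1 / 2 := by nlinarith [Real.pi_lt_four, Real.pi_pos]
  have hc0 : 0 ≤ Real.sin (Real.pi * y / 2) :=
    Real.sin_nonneg_of_nonneg_of_le_pi (by positivity) (by nlinarith [Real.pi_pos])
  set T : Finset ℤ := (Finset.range (n + 1)).map Nat.castEmbedding with hT
  have hnorm : ‖(WithLp.toLp 2 fun j : T => binomialCoeff n j : EuclideanSpace ℂ T)‖ ^ 2 =
      ((2 * n).choose n : ℝ) := by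
    rw [EuclideanSpace.norm_sq_eq]
    simp only
    rw [Finset.sum_coe_sort T fun j => ‖binomialCoeff n j‖ ^ 2, sum_norm_sq_binomialCoeff]
  have hchoose : (4 : ℝ) ^ n ≤ (2 * n + 1) * (2 * n).choose n := by
    exact_mod_cast Nat.four_pow_le_two_mul_add_one_mul_central_binom n
  have hchoose0 : (0 : ℝ) < (2 * n).choose n := by
    exact_mod_cast Nat.choose_pos (by omega)
  refine leastSingularValue_le (by positivity)
    (v := WithLp.toLp 2 fun j : T => binomialCoeff n j) ?_ ?_
  · intro h
    rw [h] at hnorm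
    simp at hnorm
    linarith
  · rw [hnorm, norm_sq_submatrix_atom hy, div_le_iff₀ (by positivity)]
    have h1 : ∀ θ, ‖expSum T (binomialCoeff n) θ‖ ^ 2 = 4 ^ n * Real.sin (θ / 2) ^ (2 * n) := by
      intro θ
      rw [expSum_binomialCoeff, norm_pow, ← pow_mul, mul_comm n 2, pow_mul, norm_one_sub_exp_sq,
        mul_pow, pow_mul]
    simp only [h1, intervalIntegral.integral_const_mul]
    have h2 := integral_sin_half_pow_le hpy hR n
    have hI : 0 ≤ ∫ θ in -(Real.pi * y)..Real.pi * y, Real.sin (θ / 2) ^ (2 * n) :=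
      intervalIntegral.integral_nonneg (by linarith) fun θ _ => (even_two_mul n).pow_nonneg _
    calc _ ≤ (2 * n + 1) * ((2 * n).choose n : ℝ) *
          ∫ θ in -(Real.pi * y)..Real.pi * y, Real.sin (θ / 2) ^ (2 * n) := by gcongr
      _ = ((2 * n).choose n : ℝ) * ((2 * n + 1) *
          ∫ θ in -(Real.pi * y)..Real.pi * y, Real.sin (θ / 2) ^ (2 * n)) := by ring
      _ ≤ ((2 * n).choose n : ℝ) *
          (4 * (Real.pi * y) * Real.sin (Real.pi * y / 2) ^ (2 * n)) := by gcongr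
      -- Pure slack: the constant `4` of the statement allows `4² * 2πy = 32πy`.
      _ ≤ ((2 * n).choose n : ℝ) *
          (32 * (Real.pi * y) * Real.sin (Real.pi * y / 2) ^ (2 * n)) := by gcongr; norm_num
      _ = _ := by rw [mul_pow, ← pow_mul, mul_comm n 2]; ring

end PartialFourier

theorem mainTheorem3 :
    ∃ C : ℝ, 0 < C ∧ ∃ yStar : ℝ, 0 < yStar ∧
      ∀ (n : ℕ) (y : ℝ), 0 < y → y < yStar →
        C * (Real.sin (Real.pi * y / 2) / 4) ^ n ≤
            PartialFourier.lowerRIC (PartialFourier.atom y) (n + 1) ∧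
          PartialFourier.lowerRIC (PartialFourier.atom y) (n + 1) ≤
            4 * Real.sin (Real.pi * y / 2) ^ n := by
  refine ⟨1 / 5, by norm_num, 1 / 10, by norm_num, fun n y hy hy1 => ?_⟩
  have hmem : PartialFourier.leastSingularValue (PartialFourier.submatrix (PartialFourier.atom y)
      ((Finset.range (n + 1)).map Nat.castEmbedding)) ∈ {s : ℝ | ∃ T : Finset ℤ, T.card = n + 1 ∧
        PartialFourier.leastSingularValue
          (PartialFourier.submatrix (PartialFourier.atom y) T) = s} :=
    ⟨_, by simp, rfl⟩
  constructor
  · refine le_csInf ⟨_, hmem⟩ ?_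
    rintro _ ⟨T, hT, rfl⟩
    exact PartialFourier.le_leastSingularValue_atom hT hy hy1.le
  · refine (csInf_le ⟨0, ?_⟩ hmem).trans (PartialFourier.leastSingularValue_atom_le n hy hy1.le)
    rintro _ ⟨T, _, rfl⟩
    exact PartialFourier.leastSingularValue_nonneg _
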